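/- Let $r, d, n \ge 0$ be integers with $r \le n$. Alice holds an index $i \in [n]=\{1,\dots,n\}$, Bob holds a set $S \subseteq [n]$ with $|S| = r$, and they want to compute the membership function $f(i,S) = 1$ if $i \in S$, $f(i,S) = 0$ otherwise. A deterministic protocol with $d$ rounds under the SpeedLimit paradigm proceeds as follows: Bob first sends Alice a bit string (a function of $S$), whose length $z = z(S) \ge 0$ is called the speed limit; then there are $d$ rounds, in each of which Alice sends a bit string of length at most $z$ (a function of $i$ and of what she has received so far) and Bob answers with one bit (a function of $S$ and of the messages he has received so far); finally Alice announces a bit (a function of $i$ and of everything she has received). There exists a deterministic protocol with $d$ rounds under the SpeedLimit paradigm that computes $f(i,S)$ correctly for all $i$ and $S$, and for which, when $S$ is uniformly distributed over the $\binom{n}{r}$ subsets of $[n]$ of size $r$, $$\mathbb{E}\left[2^{z}\right] \le 30\,(rd+1)\left((r+1)^{r+1}\binom{n}{r}\right)^{1/(rd+1)}.$$ -/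

import Mathlib

open scoped BigOperators

/-- A deterministic two-party protocol in the SpeedLimit paradigm.  Alice holds `x : X`, Bob
holds `y : Y`; messages are finite bit strings.  Bob opens with a speed-limit message
`limitMsg y`.  Then `rounds` rounds follow, each one consisting of one message of Alice and a
one-bit reply of Bob, and finally Alice announces a bit.  No message of Alice is longer than
Bob's opening message. -/
structure SpeedLimitProtocol (X Y : Type*) where
  /-- The number of rounds after Bob's opening message. -/
  rounds : ℕ
  /-- Bob's opening message, a function of his input. -/
  limitMsg : Y → List Bool
  /-- Alice's next message, a function of her input, of Bob's opening message, and of the list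
  of replies that she has received so far. -/
  query : X → List Bool → List Bool → List Bool
  /-- Bob's next one-bit reply, a function of his input and of the list of all messages that he
  has received so far. -/
  reply : Y → List (List Bool) → Bool
  /-- Alice's final announcement, a function of her input, of Bob's opening message, and of the
  list of all his replies. -/
  announce : X → List Bool → List Bool → Bool
  /-- Alice's messages obey the speed limit. -/
  query_length_le : ∀ (x : X) (m bs : List Bool), (query x m bs).length ≤ m.length

namespace SpeedLimitProtocol

/-- The messages of Alice and the replies of Bob during the first `k` rounds on the inputs `x`
and `y`, both in chronological order. -/
def transcript {X Y : Type*} (P : SpeedLimitProtocol X Y) (x : X) (y : Y) :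
    ℕ → List (List Bool) × List Bool
  | 0 => ([], [])
  | k + 1 =>
    let t := P.transcript x y k
    let qs := t.1 ++ [P.query x (P.limitMsg y) t.2]
    (qs, t.2 ++ [P.reply y qs])

/-- The bit that Alice announces after the last round. -/
def result {X Y : Type*} (P : SpeedLimitProtocol X Y) (x : X) (y : Y) : Bool :=
  P.announce x (P.limitMsg y) (P.transcript x y P.rounds).2

/-- The protocol computes `f` (without error, on all inputs). -/
def Computes {X Y : Type*} (P : SpeedLimitProtocol X Y) (f : X → Y → Bool) : Prop :=
  ∀ (x : X) (y : Y), P.result x y = f x y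

/-- The speed limit `z`: the number of bits of Bob's opening message. -/
def speedLimit {X Y : Type*} (P : SpeedLimitProtocol X Y) (y : Y) : ℕ :=
  (P.limitMsg y).length

end SpeedLimitProtocol

/-- The subsets of an `n`-element set that have exactly `r` elements. -/
abbrev RSubset (n r : ℕ) : Type := {S : Finset (Fin n) // S.card = r}

/-- The membership function: `1` if `i ∈ S` and `0` otherwise. -/
def membership (n r : ℕ) (i : Fin n) (S : RSubset n r) : Bool :=
  decide (i ∈ S.1)

/-! Bob names the first useful entry of a fixed list of pairs (T, h), where T is a set of t points
and h consists of d hash functions into C = {0,1}^z. The entry must satisfy S ⊆ T, and every point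
of T \ S must be exposed by some h k that keeps it away from h k (S). Alice sends her d hash values,
Bob reports whether each lies in the image of S, and Alice accepts iff i ∈ T and every reply is yes.
A random T contains S with probability C(t,r)/C(n,r). By a union bound (`card_separates_ge`), h then
works with probability at least 1 - (t-r)ρ, where ρ = (r/|C|)^d. Optimizing t
(`exists_retained_size`) makes the success probability at least 1/B with B = max(r+1, (r+1)^(r+1)
C(n,r) ρ^r), so a greedy list (`exists_greedy_cover`) has average index at most B. Sending index k,
padded to z bits, costs 2^length ≤ 2^z + 2(k+1), so the expectation is at most 2^z + 2B. Taking 2^z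
within a factor 2 of X = (rd+1)((r+1)^(r+1) C(n,r))^(1/(rd+1)) gives B ≤ X (`max_bound_le`), hence a
total of at most 4X. -/

/-! ### Greedy covering -/

/-- If every `y` is good for at least a `1 / B` fraction of all `g`, then a greedily chosen
sequence of `g`'s serves all `y` with average (one-based) index at most `B`. -/
theorem exists_greedy_cover {G Y : Type*} [Fintype G] [Nonempty G] (good : G → Y → Prop)
    [∀ g y, Decidable (good g y)] (B : ℝ)
    (h : ∀ y, (Fintype.card G : ℝ) ≤ B * (Finset.univ.filter fun g => good g y).card)
    (s : Finset Y) :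
    ∃ (L : ℕ → G) (ι : Y → ℕ), (∀ y ∈ s, good (L (ι y)) y) ∧
      ∑ y ∈ s, ((ι y : ℝ) + 1) ≤ B * s.card := by
  classical
  induction s using Finset.strongInduction with
  | H s ih =>
  rcases s.eq_empty_or_nonempty with rfl | hs
  · exact ⟨fun _ => Classical.arbitrary G, fun _ => 0, by simp, by simp⟩
  -- Double counting of good pairs: some `g` serves at least the average share of `s`.
  obtain ⟨g, hg⟩ : ∃ g : G, (s.card : ℝ) ≤ B * (s.filter fun y => good g y).card := by
    by_contra! hcon
    have h1 : ∑ g : G, B * ((s.filter fun y => good g y).card : ℝ) < ∑ _g : G, (s.card : ℝ) :=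
      Finset.sum_lt_sum_of_nonempty Finset.univ_nonempty fun g _ => hcon g
    have h2 : ∑ g : G, ((s.filter fun y => good g y).card : ℝ) =
        ∑ y ∈ s, ((Finset.univ.filter fun g => good g y).card : ℝ) := by
      simp only [Finset.card_filter, Nat.cast_sum]
      exact Finset.sum_comm
    have h3 : ∑ _y ∈ s, (Fintype.card G : ℝ) ≤
        ∑ y ∈ s, B * ((Finset.univ.filter fun g => good g y).card : ℝ) :=
      Finset.sum_le_sum fun y _ => h y
    rw [← Finset.mul_sum, h2, Finset.mul_sum] at h1
    simp only [Finset.sum_const, nsmul_eq_mul, Finset.card_univ] at h1 h3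
    linarith [mul_comm (s.card : ℝ) (Fintype.card G)]
  have hcard : (0 : ℝ) < s.card := by exact_mod_cast hs.card_pos
  have hsub : (s.filter fun y => ¬ good g y) ⊂ s := by
    refine Finset.filter_ssubset.2 ?_
    by_contra! hcon
    rw [Finset.filter_false_of_mem hcon] at hg
    simp only [Finset.card_empty, Nat.cast_zero, mul_zero] at hg
    linarith
  obtain ⟨L, ι, hgood, hsum⟩ := ih _ hsub
  -- Prepending `g` costs one per element of `s` in total, and `hg` pays for this with `B` per
  -- element served by `g`.
  refine ⟨fun k => Nat.casesOn k g L, fun y => if good g y then 0 else ι y + 1, ?_, ?_⟩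
  · intro y hy
    by_cases hgy : good g y
    · simp [hgy]
    · simpa [hgy] using hgood y (by simp [hy, hgy])
  · rw [← Finset.sum_filter_add_sum_filter_not s (fun y => good g y)]
    have e1 : ∑ y ∈ s.filter (fun y => good g y),
        (((if good g y then 0 else ι y + 1 : ℕ) : ℝ) + 1) =
        ((s.filter fun y => good g y).card : ℝ) := by
      rw [Finset.sum_congr rfl (g := fun _ => (1 : ℝ))]
      · simp
      · intro y hy
        simp [(Finset.mem_filter.1 hy).2]
    have e2 : ∑ y ∈ s.filter (fun y => ¬ good g y),
        (((if good g y then 0 else ι y + 1 : ℕ) : ℝ) + 1) =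
        ∑ y ∈ s.filter (fun y => ¬ good g y), ((ι y : ℝ) + 1) +
          ((s.filter fun y => ¬ good g y).card : ℝ) := by
      rw [Finset.sum_congr rfl (g := fun y => ((ι y : ℝ) + 1) + 1), Finset.sum_add_distrib]
      · simp
      · intro y hy
        simp [(Finset.mem_filter.1 hy).2]
    have e3 : ((s.filter fun y => good g y).card : ℝ) +
        ((s.filter fun y => ¬ good g y).card : ℝ) = s.card := by
      exact_mod_cast Finset.card_filter_add_card_filter_not (s := s) (fun y => good g y)
    rw [e1, e2]
    rw [← e3] at hg ⊢
    linarith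

/-! ### Random hash functions -/

section Hashing

variable {α C : Type*} [Fintype α] [DecidableEq α] [Fintype C] [DecidableEq C]

/-- Two fixed distinct points collide under at most a `1 / |C|` fraction of all functions. -/
theorem card_collision_mul_le {s x : α} (hsx : s ≠ x) :
    (Finset.univ.filter fun f : α → C => f s = f x).card * Fintype.card C ≤
      Fintype.card (α → C) := by
  rw [← Finset.card_univ (α := C), ← Finset.card_product, ← Finset.card_univ]
  -- Overwriting the value at `x` loses nothing: a colliding `f` has `f x = f s`, and `s ≠ x` is
  -- untouched.
  refine Finset.card_le_card_of_injOn (fun p => Function.update p.1 x p.2) (by simp) ?_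
  rintro ⟨f, c⟩ hf ⟨f', c'⟩ hf' heq
  simp only [Finset.coe_product, Set.mem_prod, Finset.mem_coe, Finset.mem_filter,
    Finset.mem_univ, true_and, and_true] at hf hf'
  simp only at heq
  have hc : c = c' := by simpa using congrFun heq x
  have hne : ∀ y, y ≠ x → f y = f' y := fun y hy => by simpa [hy] using congrFun heq y
  have hff : f = f' := by
    funext y
    by_cases hy : y = x
    · rw [hy, ← hf, ← hf', hne s hsx]
    · exact hne y hy
  rw [hff, hc]

/-- A fixed point outside `S` collides with a point of `S` under at most an `|S| / |C|` fraction
of all functions. -/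
theorem card_collision_set_mul_le {S : Finset α} {x : α} (hx : x ∉ S) :
    (Finset.univ.filter fun f : α → C => ∃ s ∈ S, f s = f x).card * Fintype.card C ≤
      S.card * Fintype.card (α → C) := by
  have hsub : (Finset.univ.filter fun f : α → C => ∃ s ∈ S, f s = f x) ⊆
      S.biUnion fun s => Finset.univ.filter fun f : α → C => f s = f x := by
    intro f hf
    simpa using hf
  calc _ ≤ (∑ s ∈ S, (Finset.univ.filter fun f : α → C => f s = f x).card) * Fintype.card C :=
        Nat.mul_le_mul_right _ ((Finset.card_le_card hsub).trans Finset.card_biUnion_le)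
    _ = ∑ s ∈ S, (Finset.univ.filter fun f : α → C => f s = f x).card * Fintype.card C :=
        Finset.sum_mul _ _ _
    _ ≤ ∑ _s ∈ S, Fintype.card (α → C) :=
        Finset.sum_le_sum fun s hs => card_collision_mul_le fun h => hx (h ▸ hs)
    _ = _ := by simp

/-- The version of `card_collision_set_mul_le` for `d` functions at once. -/
theorem card_collision_family_mul_le (d : ℕ) {S : Finset α} {x : α} (hx : x ∉ S) :
    (Finset.univ.filter fun h : Fin d → α → C => ∀ k, ∃ s ∈ S, h k s = h k x).card *
      Fintype.card C ^ d ≤ S.card ^ d * Fintype.card (Fin d → α → C) := by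
  have hpi : (Finset.univ.filter fun h : Fin d → α → C => ∀ k, ∃ s ∈ S, h k s = h k x) =
      Fintype.piFinset fun _ : Fin d =>
        Finset.univ.filter fun f : α → C => ∃ s ∈ S, f s = f x := by
    ext h
    simp
  rw [hpi, Fintype.card_piFinset_const, ← mul_pow, Fintype.card_fun (α := Fin d),
    Fintype.card_fin, ← mul_pow]
  exact Nat.pow_le_pow_left (card_collision_set_mul_le hx) d

/-- The family `h` of functions distinguishes every point of `T \ S` from all points of `S`. -/
def Separates {d : ℕ} (h : Fin d → α → C) (T S : Finset α) : Prop :=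
  S ⊆ T ∧ ∀ x ∈ T, x ∉ S → ∃ k, ∀ s ∈ S, h k s ≠ h k x

/-- Union bound over `T \ S`: the `d` functions are independent, so a given point escapes all of
them with probability at most (|S|/|C|)^d. -/
theorem card_separates_ge [Nonempty C] (d : ℕ) {S T : Finset α} (hST : S ⊆ T)
    [DecidablePred fun h : Fin d → α → C => Separates h T S] :
    (1 - ((T.card : ℝ) - S.card) * ((S.card : ℝ) / Fintype.card C) ^ d) *
        Fintype.card (Fin d → α → C) ≤
      (Finset.univ.filter fun h : Fin d → α → C => Separates h T S).card := by
  have hC : (0 : ℝ) < (Fintype.card C : ℝ) ^ d := by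
    have : (0 : ℝ) < Fintype.card C := by exact_mod_cast Fintype.card_pos
    positivity
  have hbad : ((Finset.univ.filter fun h : Fin d → α → C => ¬ Separates h T S).card : ℝ) ≤
      ((T.card : ℝ) - S.card) * ((S.card : ℝ) / Fintype.card C) ^ d *
        Fintype.card (Fin d → α → C) := by
    have hsub : (Finset.univ.filter fun h : Fin d → α → C => ¬ Separates h T S) ⊆
        (T \ S).biUnion fun x =>
          Finset.univ.filter fun h : Fin d → α → C => ∀ k, ∃ s ∈ S, h k s = h k x := by
      intro h hh
      simp only [Separates, hST, true_and, Finset.mem_filter, Finset.mem_univ] at hh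
      push Not at hh
      obtain ⟨x, hxT, hxS, hx⟩ := hh
      simp only [Finset.mem_biUnion, Finset.mem_sdiff, Finset.mem_filter, Finset.mem_univ,
        true_and]
      exact ⟨x, ⟨hxT, hxS⟩, hx⟩
    have h1 : ((Finset.univ.filter fun h : Fin d → α → C => ¬ Separates h T S).card : ℝ) ≤
        ∑ x ∈ T \ S, ((Finset.univ.filter fun h : Fin d → α → C =>
          ∀ k, ∃ s ∈ S, h k s = h k x).card : ℝ) := by
      exact_mod_cast (Finset.card_le_card hsub).trans Finset.card_biUnion_le
    have h2 : ∀ x ∈ T \ S, ((Finset.univ.filter fun h : Fin d → α → C =>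
          ∀ k, ∃ s ∈ S, h k s = h k x).card : ℝ) ≤
        ((S.card : ℝ) / Fintype.card C) ^ d * Fintype.card (Fin d → α → C) := by
      intro x hx
      rw [div_pow, div_mul_eq_mul_div, le_div_iff₀ hC]
      exact_mod_cast card_collision_family_mul_le d (Finset.mem_sdiff.1 hx).2
    refine h1.trans ((Finset.sum_le_sum h2).trans_eq ?_)
    rw [Finset.sum_const, nsmul_eq_mul, Finset.card_sdiff_of_subset hST,
      Nat.cast_sub (Finset.card_le_card hST), mul_assoc]
  have hsum : ((Finset.univ.filter fun h : Fin d → α → C => Separates h T S).card : ℝ) +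
      ((Finset.univ.filter fun h : Fin d → α → C => ¬ Separates h T S).card : ℝ) =
      Fintype.card (Fin d → α → C) := by
    exact_mod_cast Finset.card_filter_add_card_filter_not
      (fun h : Fin d → α → C => Separates h T S)
  linarith

end Hashing

/-! ### Random retained sets and the choice of their size -/

theorem card_rSubset (n r : ℕ) : Fintype.card (RSubset n r) = n.choose r := by
  simp [RSubset]

/-- A lower bound for the number of supersets of a given finite set. -/
theorem choose_le_card_supersets {n r t : ℕ} (hrt : r ≤ t) (S : RSubset n r) :
    (n - r).choose (t - r) ≤
      (Finset.univ.filter fun T : RSubset n t => S.1 ⊆ T.1).card := by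
  have hc : (Finset.powersetCard (t - r) S.1ᶜ).card = (n - r).choose (t - r) := by
    rw [Finset.card_powersetCard, Finset.card_compl, Fintype.card_fin, S.2]
  have hdisj : ∀ U ∈ Finset.powersetCard (t - r) S.1ᶜ, Disjoint U S.1 := fun U hU =>
    Finset.subset_compl_iff_disjoint_right.1 (Finset.mem_powersetCard.1 hU).1
  rw [← hc, ← Finset.card_map (Function.Embedding.subtype _)]
  refine Finset.card_le_card_of_injOn (fun U => U ∪ S.1) ?_ ?_
  · intro U hU
    have hcard : (U ∪ S.1).card = t := by
      rw [Finset.card_union_of_disjoint (hdisj U hU), (Finset.mem_powersetCard.1 hU).2, S.2]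
      omega
    simp [hcard]
  · intro U hU V hV heq
    have h : (U ∪ S.1) \ S.1 = (V ∪ S.1) \ S.1 := congrArg (· \ S.1) heq
    rwa [Finset.union_sdiff_right, Finset.union_sdiff_right,
      Finset.sdiff_eq_self_of_disjoint (hdisj U hU),
      Finset.sdiff_eq_self_of_disjoint (hdisj V hV)] at h

/-- Every `S` is separated by a good fraction of all pairs consisting of a `t`-subset and a
family of `d` functions. -/
theorem card_good_ge {n r t d : ℕ} {C : Type*} [Fintype C] [DecidableEq C] [Nonempty C]
    (hrt : r ≤ t) (S : RSubset n r)
    [DecidablePred fun g : RSubset n t × (Fin d → Fin n → C) => Separates g.2 g.1.1 S.1]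
    (hnonneg : 0 ≤ 1 - ((t : ℝ) - r) * ((r : ℝ) / Fintype.card C) ^ d) :
    (t.choose r : ℝ) * (1 - ((t : ℝ) - r) * ((r : ℝ) / Fintype.card C) ^ d) *
        Fintype.card (RSubset n t × (Fin d → Fin n → C)) ≤
      n.choose r * (Finset.univ.filter fun g : RSubset n t × (Fin d → Fin n → C) =>
        Separates g.2 g.1.1 S.1).card := by
  classical
  set c : ℝ := 1 - ((t : ℝ) - r) * ((r : ℝ) / Fintype.card C) ^ d with hcdef
  have hfib : (Finset.univ.filter fun g : RSubset n t × (Fin d → Fin n → C) =>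
        Separates g.2 g.1.1 S.1).card =
      ∑ T : RSubset n t, (Finset.univ.filter fun h : Fin d → Fin n → C =>
        Separates h T.1 S.1).card := by
    simp only [Finset.card_filter, Fintype.sum_prod_type]
    exact Finset.sum_congr rfl fun T _ => Finset.sum_congr rfl fun h _ => by
      congr
  have h1 : ((Finset.univ.filter fun T : RSubset n t => S.1 ⊆ T.1).card : ℝ) *
      (c * Fintype.card (Fin d → Fin n → C)) ≤
      ((Finset.univ.filter fun g : RSubset n t × (Fin d → Fin n → C) =>
        Separates g.2 g.1.1 S.1).card : ℝ) := by
    rw [hfib, Nat.cast_sum, ← nsmul_eq_mul, ← Finset.sum_const]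
    refine (Finset.sum_le_sum fun T hT => ?_).trans
      (Finset.sum_le_sum_of_subset_of_nonneg (Finset.filter_subset _ _) fun _ _ _ => by positivity)
    have := card_separates_ge (C := C) d (Finset.mem_filter.1 hT).2
    rwa [S.2, T.2] at this
  have h2 : ((n - r).choose (t - r) : ℝ) ≤
      ((Finset.univ.filter fun T : RSubset n t => S.1 ⊆ T.1).card : ℝ) := by
    exact_mod_cast choose_le_card_supersets hrt S
  -- This identity turns the probability C(n-r,t-r)/C(n,t) of S ⊆ T into C(t,r)/C(n,r).
  have h3 : (n.choose t : ℝ) * t.choose r = n.choose r * (n - r).choose (t - r) := by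
    exact_mod_cast Nat.choose_mul hrt
  have h4 : (0 : ℝ) ≤ c * Fintype.card (Fin d → Fin n → C) := by positivity
  rw [Fintype.card_prod, card_rSubset, Nat.cast_mul]
  calc (t.choose r : ℝ) * c * (n.choose t * Fintype.card (Fin d → Fin n → C))
      = n.choose r * ((n - r).choose (t - r) * (c * Fintype.card (Fin d → Fin n → C))) := by
        linear_combination (c * Fintype.card (Fin d → Fin n → C)) * h3
    _ ≤ _ := by
        gcongr
        exact (mul_le_mul_of_nonneg_right h2 h4).trans h1

/-- The choice of the number `t` of retained points. -/
theorem exists_retained_size {n r : ℕ} (hrn : r ≤ n) {ρ : ℝ} (hρ : 0 ≤ ρ) :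
    ∃ t, r ≤ t ∧ t ≤ n ∧ 0 ≤ 1 - ((t : ℝ) - r) * ρ ∧
      (n.choose r : ℝ) ≤ max ((r : ℝ) + 1) (((r : ℝ) + 1) ^ (r + 1) * n.choose r * ρ ^ r) *
        (t.choose r * (1 - ((t : ℝ) - r) * ρ)) := by
  have hr1 : (0 : ℝ) < (r : ℝ) + 1 := by positivity
  have hN : (0 : ℝ) ≤ n.choose r := by positivity
  set B := max ((r : ℝ) + 1) (((r : ℝ) + 1) ^ (r + 1) * n.choose r * ρ ^ r) with hB
  -- The threshold r/(r+1) for uρ maximizes u^r (1 - uρ), the leading behaviour of the success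
  -- probability for u = t - r.
  have key : ∀ u : ℝ, u * ρ ≤ r / (r + 1) → 1 / ((r : ℝ) + 1) ≤ 1 - u * ρ := by
    intro u hu
    have : 1 / ((r : ℝ) + 1) = 1 - r / (r + 1) := by field_simp; ring
    linarith
  -- If even t = n stays below the threshold, all points are retained; this gives the term r+1 of
  -- the maximum.
  by_cases hcase : ((n : ℝ) - r) * ρ ≤ r / (r + 1)
  · have h := key _ hcase
    refine ⟨n, hrn, le_rfl, le_trans (by positivity) h, ?_⟩
    calc (n.choose r : ℝ) = ((r : ℝ) + 1) * (n.choose r * (1 / ((r : ℝ) + 1))) := by field_simp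
      _ ≤ _ := by
        gcongr
        exact le_max_left _ _
  · push Not at hcase
    have hρ0 : 0 < ρ := by
      rcases hρ.eq_or_lt with h | h
      · rw [← h, mul_zero] at hcase
        exact absurd hcase (not_lt.2 (by positivity))
      · exact h
    set w : ℝ := r / (r + 1) / ρ with hw
    have hw0 : 0 ≤ w := by positivity
    have hwn : w < (n : ℝ) - r := by rwa [hw, div_lt_iff₀ hρ0]
    have hfl : (⌊w⌋₊ : ℝ) ≤ w := Nat.floor_le hw0
    have hsmall : ((r + ⌊w⌋₊ : ℕ) - (r : ℝ)) * ρ ≤ r / (r + 1) := by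
      push_cast
      rw [add_sub_cancel_left]
      exact (le_div_iff₀ hρ0).1 hfl
    have h := key _ hsmall
    refine ⟨r + ⌊w⌋₊, by omega, ?_, le_trans (by positivity) h, ?_⟩
    · have : ((r + ⌊w⌋₊ : ℕ) : ℝ) ≤ n := by push_cast; linarith
      exact_mod_cast this
    -- Rounding `w` down is harmless: C(r+⌊w⌋, r) r! is a product of r factors, each at least ⌊w⌋+1
    -- > w.
    · have hch : w ^ r * (r.factorial : ℝ)⁻¹ ≤ (r + ⌊w⌋₊).choose r := by
        have h1 : w ^ r ≤ ((⌊w⌋₊ : ℝ) + 1) ^ r :=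
          pow_le_pow_left₀ hw0 (Nat.lt_floor_add_one w).le r
        have h2 : ((⌊w⌋₊ : ℝ) + 1) ^ r ≤ r.factorial * (r + ⌊w⌋₊).choose r := by
          have := Nat.pow_succ_le_ascFactorial (⌊w⌋₊ + 1) r
          rw [Nat.ascFactorial_eq_factorial_mul_choose, add_comm ⌊w⌋₊ r] at this
          exact_mod_cast this
        rw [← div_eq_mul_inv, div_le_iff₀ (by positivity), mul_comm _ (r.factorial : ℝ)]
        exact h1.trans h2
      have hrf : (1 : ℝ) ≤ (r : ℝ) ^ r * (r.factorial : ℝ)⁻¹ := by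
        rw [← div_eq_mul_inv, one_le_div (by positivity)]
        exact_mod_cast Nat.factorial_le_pow r
      calc (n.choose r : ℝ) ≤ n.choose r * ((r : ℝ) ^ r * (r.factorial : ℝ)⁻¹) :=
            le_mul_of_one_le_right hN hrf
        _ = (((r : ℝ) + 1) ^ (r + 1) * n.choose r * ρ ^ r) *
              (w ^ r * (r.factorial : ℝ)⁻¹ * (1 / ((r : ℝ) + 1))) := by
            rw [hw, div_pow, div_pow, pow_succ]
            field_simp
        _ ≤ _ := by
            gcongr
            exact le_max_right _ _

/-- A sequence of pairs that separates all `r`-subsets with small average index. -/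
theorem exists_separating_sequence {n r : ℕ} (hrn : r ≤ n) (d : ℕ) (C : Type*) [Fintype C]
    [Nonempty C] :
    ∃ (L : ℕ → Finset (Fin n) × (Fin d → Fin n → C)) (ι : RSubset n r → ℕ),
      (∀ S, Separates (L (ι S)).2 (L (ι S)).1 S.1) ∧
      ∑ S, ((ι S : ℝ) + 1) ≤
        max ((r : ℝ) + 1) (((r : ℝ) + 1) ^ (r + 1) * n.choose r *
          (((r : ℝ) / Fintype.card C) ^ d) ^ r) * n.choose r := by
  classical
  obtain ⟨t, hrt, htn, h0, hB⟩ := exists_retained_size hrn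
    (show (0 : ℝ) ≤ ((r : ℝ) / Fintype.card C) ^ d by positivity)
  set B := max ((r : ℝ) + 1) (((r : ℝ) + 1) ^ (r + 1) * n.choose r *
          (((r : ℝ) / Fintype.card C) ^ d) ^ r) with hBdef
  have : Nonempty (RSubset n t) := by
    rw [← Fintype.card_pos_iff, card_rSubset]
    exact Nat.choose_pos htn
  obtain ⟨L, ι, hgood, hsum⟩ := exists_greedy_cover
    (fun (g : RSubset n t × (Fin d → Fin n → C)) (S : RSubset n r) =>
      Separates g.2 g.1.1 S.1) B (fun S => by
        have h1 := card_good_ge (C := C) (d := d) hrt S h0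
        have hB0 : 0 ≤ B := le_trans (by positivity) (le_max_left _ _)
        have hN : (0 : ℝ) < n.choose r := by exact_mod_cast Nat.choose_pos hrn
        refine le_of_mul_le_mul_left ?_ hN
        calc _ ≤ B * (t.choose r * (1 - ((t : ℝ) - r) * ((r : ℝ) / Fintype.card C) ^ d)) *
              Fintype.card (RSubset n t × (Fin d → Fin n → C)) := by gcongr
          _ = B * (t.choose r * (1 - ((t : ℝ) - r) * ((r : ℝ) / Fintype.card C) ^ d) *
              Fintype.card (RSubset n t × (Fin d → Fin n → C))) := by ring
          _ ≤ _ := (mul_le_mul_of_nonneg_left h1 hB0).trans_eq (by ring)) Finset.univ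
  refine ⟨fun k => ((L k).1.1, (L k).2), ι, fun S => hgood S (Finset.mem_univ S), ?_⟩
  rwa [Finset.card_univ, card_rSubset] at hsum

/-! ### Padded binary encoding of indices -/

/-- The number with the given binary digits, least significant digit first. -/
def numberOfBits (l : List Bool) : ℕ :=
  l.foldr Nat.bit 0

/-- The binary digits of `k`, least significant digit first, padded with zeros to length at least
`z`. -/
def paddedBits (z k : ℕ) : List Bool :=
  k.bits ++ List.replicate (z - k.size) false

theorem numberOfBits_replicate_false (j : ℕ) : numberOfBits (List.replicate j false) = 0 := by
  induction j with
  | zero => rfl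
  | succ j ih =>
    rw [numberOfBits] at ih ⊢
    rw [List.replicate_succ, List.foldr_cons, ih]
    rfl

theorem numberOfBits_bits (k : ℕ) : numberOfBits k.bits = k := by
  induction k using Nat.binaryRec' with
  | zero => simp [numberOfBits]
  | bit b n h ih =>
    rw [numberOfBits] at ih ⊢
    rw [Nat.bits_append_bit n b h, List.foldr_cons, ih]

theorem numberOfBits_paddedBits (z k : ℕ) : numberOfBits (paddedBits z k) = k := by
  have h := numberOfBits_replicate_false (z - k.size)
  rw [numberOfBits] at h
  rw [paddedBits, numberOfBits, List.foldr_append, h]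
  exact numberOfBits_bits k

theorem length_paddedBits (z k : ℕ) : (paddedBits z k).length = max z k.size := by
  rw [paddedBits, List.length_append, Nat.size_eq_bits_len, List.length_replicate]
  omega

theorem two_pow_size_le (k : ℕ) : 2 ^ k.size ≤ 2 * (k + 1) := by
  rcases h : k.size with _ | j
  · omega
  · have : 2 ^ j ≤ k := Nat.lt_size.1 (by omega)
    rw [pow_succ]
    omega

/-- The exponential cost is linear in the index, so a bound on the average index suffices. -/
theorem two_pow_length_paddedBits_le (z k : ℕ) :
    (2 : ℝ) ^ (paddedBits z k).length ≤ 2 ^ z + 2 * ((k : ℝ) + 1) := by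
  have h : (2 : ℝ) ^ k.size ≤ 2 * ((k : ℝ) + 1) := by exact_mod_cast two_pow_size_le k
  have hz : (0 : ℝ) ≤ 2 ^ z := by positivity
  have hk : (0 : ℝ) ≤ 2 ^ k.size := by positivity
  rw [length_paddedBits]
  rcases max_cases z k.size with ⟨e, _⟩ | ⟨e, _⟩ <;> rw [e] <;> linarith

/-! ### The hashing protocol -/

open Classical in
/-- Bob announces an index `ι S` into a fixed sequence of pairs, each consisting of a set of
retained points and a family of `d` hash functions.  In round `k` Alice sends the `k`-th hash value
of her input, and Bob tells whether it is the hash value of a point of `S`. -/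
noncomputable def hashingProtocol {n r d z : ℕ}
    (L : ℕ → Finset (Fin n) × (Fin d → Fin n → List.Vector Bool z)) (ι : RSubset n r → ℕ) :
    SpeedLimitProtocol (Fin n) (RSubset n r) where
  rounds := d
  limitMsg S := paddedBits z (ι S)
  query x m bs :=
    -- The number of replies received is the round number. The truncation only enforces the speed
    -- limit for arbitrary `m`; padding makes Bob's actual message at least `z` bits long.
    if h : bs.length < d then ((L (numberOfBits m)).2 ⟨bs.length, h⟩ x).toList.take m.length
    else []
  reply S qs :=
    -- `qs` already contains the query being answered, hence the shift by one.
    if h : qs.length - 1 < d then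
      decide (∃ s ∈ S.1, qs.getLast? = some ((L (ι S)).2 ⟨qs.length - 1, h⟩ s).toList)
    else false
  announce x m bs := decide (x ∈ (L (numberOfBits m)).1) && bs.all id
  query_length_le x m bs := by
    split
    · exact List.length_take_le _ _
    · simp

section Protocol

variable {n r d z : ℕ} (L : ℕ → Finset (Fin n) × (Fin d → Fin n → List.Vector Bool z))
  (ι : RSubset n r → ℕ)

/-- The lengths belong to the invariant because both parties read the round number off them. -/
theorem hashingProtocol_transcript (x : Fin n) (S : RSubset n r) (k : ℕ) (hk : k ≤ d) :
    ((hashingProtocol L ι).transcript x S k).1.length = k ∧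
    ((hashingProtocol L ι).transcript x S k).2.length = k ∧
    (((hashingProtocol L ι).transcript x S k).2.all id = true ↔
      ∀ j : Fin d, j.1 < k → ∃ s ∈ S.1, (L (ι S)).2 j s = (L (ι S)).2 j x) := by
  induction k with
  | zero => simp [SpeedLimitProtocol.transcript]
  | succ k ih =>
    obtain ⟨h1, h2, h3⟩ := ih (by omega)
    refine ⟨by simp [SpeedLimitProtocol.transcript, h1],
      by simp [SpeedLimitProtocol.transcript, h2], ?_⟩
    have hkd : k < d := by omega
    have hq : (hashingProtocol L ι).query x ((hashingProtocol L ι).limitMsg S)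
        ((hashingProtocol L ι).transcript x S k).2 = ((L (ι S)).2 ⟨k, hkd⟩ x).toList := by
      simp only [hashingProtocol] at h2 ⊢
      rw [dif_pos (by rw [h2]; exact hkd), numberOfBits_paddedBits, List.take_of_length_le]
      · simp only [h2]
      · rw [length_paddedBits, List.Vector.toList_length]
        exact le_max_left _ _
    have hr : (hashingProtocol L ι).reply S (((hashingProtocol L ι).transcript x S k).1 ++
        [((L (ι S)).2 ⟨k, hkd⟩ x).toList]) = true ↔
        ∃ s ∈ S.1, (L (ι S)).2 ⟨k, hkd⟩ s = (L (ι S)).2 ⟨k, hkd⟩ x := by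
      have hlen : (((hashingProtocol L ι).transcript x S k).1 ++
          [((L (ι S)).2 ⟨k, hkd⟩ x).toList]).length - 1 = k := by simp [h1]
      have hlast : (((hashingProtocol L ι).transcript x S k).1 ++
          [((L (ι S)).2 ⟨k, hkd⟩ x).toList]).getLast? =
          some ((L (ι S)).2 ⟨k, hkd⟩ x).toList := by simp
      generalize ((hashingProtocol L ι).transcript x S k).1 ++
          [((L (ι S)).2 ⟨k, hkd⟩ x).toList] = qs at hlen hlast ⊢
      subst hlen
      simp only [hashingProtocol, hkd, dif_pos, hlast, decide_eq_true_iff, Option.some.injEq]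
      refine exists_congr fun s => and_congr_right fun _ => ?_
      rw [eq_comm]
      exact (List.Vector.toList_injective).eq_iff
    simp only [SpeedLimitProtocol.transcript, hq, List.all_append, Bool.and_eq_true, h3,
      List.all_cons, List.all_nil, Bool.and_true, id, hr]
    constructor
    · rintro ⟨ha, hb⟩ j hj
      rcases Nat.lt_succ_iff_lt_or_eq.1 hj with h | h
      · exact ha j h
      · obtain rfl : j = ⟨k, hkd⟩ := Fin.ext h
        exact hb
    · intro h
      exact ⟨fun j hj => h j (by omega), h ⟨k, hkd⟩ (Nat.lt_succ_self k)⟩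

theorem hashingProtocol_computes
    (hL : ∀ S : RSubset n r, Separates (L (ι S)).2 (L (ι S)).1 S.1) :
    (hashingProtocol L ι).Computes (membership n r) := by
  intro x S
  obtain ⟨-, -, h⟩ := hashingProtocol_transcript L ι x S d le_rfl
  rw [Bool.eq_iff_iff]
  change (decide (x ∈ (L (numberOfBits (paddedBits z (ι S)))).1) &&
    ((hashingProtocol L ι).transcript x S d).2.all id) = true ↔ _
  rw [numberOfBits_paddedBits, Bool.and_eq_true, h, membership, decide_eq_true_iff,
    decide_eq_true_iff]
  constructor
  · rintro ⟨hxT, hx⟩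
    by_contra hxS
    obtain ⟨k, hk⟩ := (hL S).2 x hxT hxS
    obtain ⟨s, hs, hsx⟩ := hx k k.2
    exact hk s hs hsx
  · exact fun hx => ⟨(hL S).1 hx, fun j _ => ⟨x, hx, rfl⟩⟩

theorem hashingProtocol_expect_le (hrn : r ≤ n) (B : ℝ)
    (hB : ∑ S, ((ι S : ℝ) + 1) ≤ B * n.choose r) :
    (𝔼 S : RSubset n r, (2 : ℝ) ^ (hashingProtocol L ι).speedLimit S) ≤ 2 ^ z + 2 * B := by
  have hN : (0 : ℝ) < n.choose r := by exact_mod_cast Nat.choose_pos hrn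
  rw [Fintype.expect_eq_sum_div_card, card_rSubset, div_le_iff₀ hN]
  calc ∑ S, (2 : ℝ) ^ (hashingProtocol L ι).speedLimit S
      ≤ ∑ S : RSubset n r, ((2 : ℝ) ^ z + 2 * ((ι S : ℝ) + 1)) :=
        Finset.sum_le_sum fun S _ => two_pow_length_paddedBits_le z (ι S)
    _ = 2 ^ z * n.choose r + 2 * ∑ S, ((ι S : ℝ) + 1) := by
        rw [Finset.sum_add_distrib, ← Finset.mul_sum, Finset.sum_const, Finset.card_univ,
          card_rSubset, nsmul_eq_mul, mul_comm]
    _ ≤ _ := by linarith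

end Protocol

/-! ### Balancing the parameters -/

theorem exists_two_pow_between (x : ℝ) (hx : 1 ≤ x) : ∃ z : ℕ, x ≤ 2 ^ z ∧ (2 : ℝ) ^ z ≤ 2 * x := by
  obtain ⟨k, hk1, hk2⟩ := exists_nat_pow_near hx (one_lt_two)
  refine ⟨k + 1, hk2.le, ?_⟩
  rw [pow_succ]
  linarith

/-- The number of hash values `m` balances the two terms of the bound. -/
theorem max_bound_le (r d : ℕ) {A m : ℝ} (hA : (r : ℝ) + 1 ≤ A)
    (hm : ((r : ℝ) * d + 1) * A ^ (1 / ((r : ℝ) * d + 1)) ≤ m) :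
    max ((r : ℝ) + 1) (A * (((r : ℝ) / m) ^ d) ^ r) ≤
      ((r : ℝ) * d + 1) * A ^ (1 / ((r : ℝ) * d + 1)) := by
  have hr0 : (0 : ℝ) ≤ r := r.cast_nonneg
  have hA1 : 1 ≤ A := by linarith
  have hA0 : 0 < A := by linarith
  rcases Nat.eq_zero_or_pos d with rfl | hd
  -- Without rounds the exponent is 1 and both sides equal A; the estimate r ≤ rd used below needs d
  -- ≥ 1.
  · simpa using hA
  have hd1 : (1 : ℝ) ≤ d := by exact_mod_cast hd
  have hrd : (r : ℝ) ≤ r * d := le_mul_of_one_le_right hr0 hd1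
  set e : ℝ := (r : ℝ) * d + 1 with he
  have he1 : 1 ≤ e := by linarith
  set a : ℝ := A ^ (1 / e) with ha
  have ha1 : 1 ≤ a := Real.one_le_rpow hA1 (by positivity)
  have hae : a ^ (r * d + 1) = A := by
    rw [ha, ← Real.rpow_natCast, ← Real.rpow_mul hA0.le]
    push_cast
    rw [← he, one_div_mul_cancel (by positivity), Real.rpow_one]
  have hm0 : 0 < m := lt_of_lt_of_le (by positivity) hm
  refine max_le ?_ ?_
  · nlinarith
  -- Since r ≤ rd+1, the choice of `m` gives r/m ≤ 1/a, and A a^(-rd) = a because A = a^(rd+1).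
  · have hrm : (r : ℝ) / m ≤ a⁻¹ := by
      rw [div_le_iff₀ hm0, inv_mul_eq_div, le_div_iff₀ (by positivity)]
      refine le_trans ?_ hm
      gcongr
      linarith
    calc A * (((r : ℝ) / m) ^ d) ^ r ≤ A * ((a⁻¹) ^ d) ^ r := by gcongr
      _ = a := by
        rw [← hae, ← pow_mul, mul_comm d r, pow_succ, mul_right_comm, ← mul_pow,
          mul_inv_cancel₀ (by positivity), one_pow, one_mul]
      _ ≤ e * a := le_mul_of_one_le_left (by positivity) he1

theorem corollary3 (r d n : ℕ) (hrn : r ≤ n) :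
    ∃ P : SpeedLimitProtocol (Fin n) (RSubset n r),
      P.rounds = d ∧
      P.Computes (membership n r) ∧
      (𝔼 S : RSubset n r, (2 : ℝ) ^ P.speedLimit S) ≤
        30 * ((r : ℝ) * d + 1) *
          (((r : ℝ) + 1) ^ (r + 1) * (n.choose r : ℝ)) ^ (1 / ((r : ℝ) * d + 1)) := by
  have hN : (1 : ℝ) ≤ n.choose r := by exact_mod_cast Nat.choose_pos hrn
  have hr1 : (1 : ℝ) ≤ (r : ℝ) + 1 := by linarith [(r.cast_nonneg : (0 : ℝ) ≤ r)]
  have hA : (r : ℝ) + 1 ≤ ((r : ℝ) + 1) ^ (r + 1) * n.choose r :=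
    (le_self_pow₀ hr1 (Nat.succ_ne_zero r)).trans (le_mul_of_one_le_right (by positivity) hN)
  have hrd : (0 : ℝ) ≤ (r : ℝ) * d := by positivity
  have hX : 1 ≤ ((r : ℝ) * d + 1) *
      (((r : ℝ) + 1) ^ (r + 1) * (n.choose r : ℝ)) ^ (1 / ((r : ℝ) * d + 1)) :=
    one_le_mul_of_one_le_of_one_le (by linarith)
      (Real.one_le_rpow (hr1.trans hA) (by positivity))
  obtain ⟨z, hz1, hz2⟩ := exists_two_pow_between _ hX
  have hmax := max_bound_le r d hA hz1
  obtain ⟨L, ι, hL, hι⟩ := exists_separating_sequence hrn d (List.Vector Bool z)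
  rw [card_vector, Fintype.card_bool, Nat.cast_pow, Nat.cast_ofNat] at hι
  refine ⟨hashingProtocol L ι, rfl, hashingProtocol_computes L ι hL, ?_⟩
  refine (hashingProtocol_expect_le L ι hrn _ hι).trans ?_
  rw [mul_assoc 30]
  -- Both 2^z and twice the average index are at most 2X, so 4X would already do.
  linarith
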